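/- Let $p$ be a prime number, let $F$ be a free unital associative $\mathbb{F}_p$-algebra (on an arbitrary set of generators), and let $I \subseteq F$ be a two-sided ideal. For a positive integer $m$, view the two-sided ideal $I^m$ as an associative ring without unit, and let $\mathbb{Z} \ltimes I^m$ be the unital associative ring with underlying abelian group $\mathbb{Z} \times I^m$ and multiplication $(a,x)(a',x') = (aa',\, ax' + a'x + xx')$. Regard $\mathbb{Z}$ as a left and as a right module over this ring via the augmentation $(a,x) \mapsto a$. Then, for every integer $q > 0$, the pro-abelian group $$\{\operatorname{Tor}_q^{\mathbb{Z} \ltimes I^m}(\mathbb{Z},\mathbb{Z})\}_{m \geqslant 1},$$ with structure maps induced by the inclusions $I^{n} \subseteq I^{m}$, $n \geqslant m$, is zero. That is, for every $m \geqslant 1$ there exists $m' \geqslant m$ such that the map $$\operatorname{Tor}_q^{\mathbb{Z} \ltimes I^{m'}}(\mathbb{Z},\mathbb{Z}) \to \operatorname{Tor}_q^{\mathbb{Z} \ltimes I^m}(\mathbb{Z},\mathbb{Z})$$ is zero. -/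

import Mathlib

open CategoryTheory

universe v u

noncomputable section

namespace ProTor

open scoped TensorProduct

/-! ### The tensor product over a (not necessarily commutative) ring -/

section TensorOver

variable (R : Type*) [Ring R] (M N : Type*) [AddCommGroup M] [Module Rᵐᵒᵖ M]
  [AddCommGroup N] [Module R N]

/-- The subgroup of `M ⊗_ℤ N` generated by the elements `m r ⊗ n - m ⊗ r n`. -/
def balancing : AddSubgroup (M ⊗[ℤ] N) :=
  AddSubgroup.closure
    {t | ∃ (m : M) (r : R) (n : N), t = (MulOpposite.op r • m) ⊗ₜ[ℤ] n - m ⊗ₜ[ℤ] (r • n)}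

/-- The abelian group `M ⊗_R N`, for a right `R`-module `M` and a left `R`-module `N`.
Right modules are modules over the opposite ring. -/
def TensorOver : Type _ := (M ⊗[ℤ] N) ⧸ balancing R M N

instance : AddCommGroup (TensorOver R M N) :=
  inferInstanceAs (AddCommGroup ((M ⊗[ℤ] N) ⧸ balancing R M N))

variable {M N} in
/-- The class of `m ⊗ n` in `M ⊗_R N`. -/
def TensorOver.tmul (m : M) (n : N) : TensorOver R M N :=
  QuotientAddGroup.mk' (balancing R M N) (m ⊗ₜ[ℤ] n)

variable {R M N}

theorem TensorOver.smul_tmul (m : M) (r : R) (n : N) :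
    TensorOver.tmul R (MulOpposite.op r • m) n = TensorOver.tmul R m (r • n) := by
  refine (QuotientAddGroup.eq_iff_sub_mem).2 ?_
  exact AddSubgroup.subset_closure ⟨m, r, n, rfl⟩

theorem TensorOver.hom_ext {B : Type*} [AddCommGroup B] {f g : TensorOver R M N →+ B}
    (h : ∀ m n, f (TensorOver.tmul R m n) = g (TensorOver.tmul R m n)) : f = g := by
  refine QuotientAddGroup.addMonoidHom_ext (balancing R M N) ?_
  ext t
  induction t using TensorProduct.induction_on with
  | zero => rw [map_zero, map_zero]
  | tmul m n => exact h m n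
  | add x y hx hy => rw [map_add, map_add, hx, hy]

variable {S : Type*} [Ring S] {M' N' : Type*} [AddCommGroup M'] [Module Sᵐᵒᵖ M']
  [AddCommGroup N'] [Module S N']

/-- The map `M ⊗_R N → M' ⊗_S N'` that takes `m ⊗ n` to `f m ⊗ g n`, where `f` and `g` are
semilinear with respect to a ring homomorphism `φ : R → S`. -/
def TensorOver.map (φ : R →+* S) (f : M →+ M') (g : N →+ N')
    (hf : ∀ r m, f (MulOpposite.op r • m) = MulOpposite.op (φ r) • f m)
    (hg : ∀ r n, g (r • n) = φ r • g n) :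
    TensorOver R M N →+ TensorOver S M' N' :=
  QuotientAddGroup.map (balancing R M N) (balancing S M' N')
    (TensorProduct.map f.toIntLinearMap g.toIntLinearMap).toAddMonoidHom (by
      refine (AddSubgroup.closure_le _).2 ?_
      rintro _ ⟨m, r, n, rfl⟩
      refine AddSubgroup.subset_closure ⟨f m, φ r, g n, ?_⟩
      simp [hf, hg])

@[simp]
theorem TensorOver.map_tmul (φ : R →+* S) (f : M →+ M') (g : N →+ N') (hf hg) (m : M) (n : N) :
    TensorOver.map φ f g hf hg (TensorOver.tmul R m n) = TensorOver.tmul S (f m) (g n) :=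
  rfl

theorem TensorOver.tmul_add (m : M) (n n' : N) :
    TensorOver.tmul R m (n + n') = TensorOver.tmul R m n + TensorOver.tmul R m n' := by
  exact congrArg (QuotientAddGroup.mk' (balancing R M N)) (TensorProduct.tmul_add m n n')

end TensorOver

/-! ### Tor over a ring -/

section Tor

variable {R : Type u} [Ring R]

/-- The functor `N ↦ M ⊗_R N` from left `R`-modules to abelian groups. -/
def tensorFunctor (M : ModuleCat.{v} Rᵐᵒᵖ) : ModuleCat.{v} R ⥤ AddCommGrpCat.{v} where
  obj N := AddCommGrpCat.of (TensorOver R M N)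
  map {N N'} g := AddCommGrpCat.ofHom
    (TensorOver.map (RingHom.id R) (AddMonoidHom.id M) g.hom.toAddMonoidHom
      (fun _ _ ↦ rfl) (fun r n ↦ g.hom.map_smul r n))
  map_id N := by
    ext1
    exact TensorOver.hom_ext fun _ _ ↦ rfl
  map_comp f g := by
    ext1
    exact TensorOver.hom_ext fun _ _ ↦ rfl

instance (M : ModuleCat.{v} Rᵐᵒᵖ) : (tensorFunctor M).Additive where
  map_add {N N' f g} := by
    ext1
    exact TensorOver.hom_ext fun m n ↦ TensorOver.tmul_add m (f.hom n) (g.hom n)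

/-- `Tor_q^R(M, N)`, for a right `R`-module `M` and a left `R`-module `N`: the value at `N` of
the `q`-th left derived functor of `M ⊗_R -`. -/
def tor [Small.{v} R] (M : ModuleCat.{v} Rᵐᵒᵖ) (N : ModuleCat.{v} R) (q : ℕ) :
    AddCommGrpCat.{v} :=
  ((tensorFunctor M).leftDerived q).obj N

end Tor

/-! ### Comparison of resolutions -/

section Comparison

variable {C : Type*} [Category* C] [Abelian C] {Y Z : C}

/-- A morphism lifts to a chain map from a projective resolution of the source to any
resolution `K` of the target. -/
theorem exists_lift (P : ProjectiveResolution Y) (K : ChainComplex C ℕ) (ε : K.X 0 ⟶ Z)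
    (hε : Epi ε) (w : K.d 1 0 ≫ ε = 0) (h₀ : (ShortComplex.mk _ _ w).Exact)
    (h : ∀ n, (ShortComplex.mk _ _ (K.d_comp_d (n + 2) (n + 1) n)).Exact) (f : Y ⟶ Z) :
    ∃ g : P.complex ⟶ K, g.f 0 ≫ ε = P.π.f 0 ≫ f := by
  let g₀ : P.complex.X 0 ⟶ K.X 0 := Projective.factorThru (P.π.f 0 ≫ f) ε
  have hg₀ : g₀ ≫ ε = P.π.f 0 ≫ f := Projective.factorThru_comp _ _
  have hz : (P.complex.d 1 0 ≫ g₀) ≫ ε = 0 := by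
    rw [Category.assoc, hg₀]
    exact (P.complex_d_comp_π_f_zero_assoc f).trans Limits.zero_comp
  let g₁ : P.complex.X 1 ⟶ K.X 1 := h₀.liftFromProjective (P.complex.d 1 0 ≫ g₀) hz
  have hg₁ : g₁ ≫ K.d 1 0 = P.complex.d 1 0 ≫ g₀ := h₀.liftFromProjective_comp _ _
  refine ⟨ChainComplex.mkHom _ _ g₀ g₁ hg₁ fun n ⟨a, a', ha⟩ ↦
    ⟨(h n).liftFromProjective (P.complex.d (n + 2) (n + 1) ≫ a') ?_,
      (h n).liftFromProjective_comp _ _⟩, ?_⟩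
  · dsimp
    rw [Category.assoc, ha, P.complex.d_comp_d_assoc, Limits.zero_comp]
  · simpa using hg₀

/-- Two lifts of the same morphism are homotopic. -/
theorem nonempty_homotopy (P : ProjectiveResolution Y) (K : ChainComplex C ℕ) (ε : K.X 0 ⟶ Z)
    (w : K.d 1 0 ≫ ε = 0) (h₀ : (ShortComplex.mk _ _ w).Exact)
    (h : ∀ n, (ShortComplex.mk _ _ (K.d_comp_d (n + 2) (n + 1) n)).Exact)
    (g g' : P.complex ⟶ K) (hg : g.f 0 ≫ ε = g'.f 0 ≫ ε) : Nonempty (Homotopy g g') := by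
  let f := g - g'
  have hf : f.f 0 ≫ ε = 0 := by
    change (g.f 0 - g'.f 0) ≫ ε = 0
    rw [Preadditive.sub_comp, hg, sub_self]
  let s₀ : P.complex.X 0 ⟶ K.X 1 := h₀.liftFromProjective (f.f 0) hf
  have hs₀ : s₀ ≫ K.d 1 0 = f.f 0 := h₀.liftFromProjective_comp _ _
  have hz : (f.f 1 - P.complex.d 1 0 ≫ s₀) ≫ K.d 1 0 = 0 := by
    rw [Preadditive.sub_comp, Category.assoc, hs₀, HomologicalComplex.Hom.comm, sub_self]
  let s₁ : P.complex.X 1 ⟶ K.X 2 := (h 0).liftFromProjective _ hz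
  have hs₁ : s₁ ≫ K.d 2 1 = f.f 1 - P.complex.d 1 0 ≫ s₀ := (h 0).liftFromProjective_comp _ _
  refine ⟨Homotopy.equivSubZero.invFun (Homotopy.mkInductive f s₀ hs₀.symm s₁
    (by rw [hs₁]; abel) fun n ⟨a, a', ha⟩ ↦
      ⟨(h (n + 1)).liftFromProjective (f.f (n + 2) - P.complex.d _ _ ≫ a') ?_, ?_⟩)⟩
  · dsimp
    simp [ha]
  · rw [(h (n + 1)).liftFromProjective_comp]
    abel

end Comparison

/-! ### Functoriality of Tor in the ring -/

section ChangeOfRings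

variable {R : Type u} {S : Type u} {T : Type u} [Ring R] [Ring S] [Ring T]

/-- Restriction of scalars of chain complexes. -/
abbrev resComplex (φ : R →+* S) (K : ChainComplex (ModuleCat.{v} S) ℕ) :
    ChainComplex (ModuleCat.{v} R) ℕ :=
  ((ModuleCat.restrictScalars φ).mapHomologicalComplex _).obj K

/-- `M ⊗_R N → M' ⊗_S N'` for `φ`-semilinear maps `M → M'` and `N → N'`. -/
def tensorChange (φ : R →+* S) {M : ModuleCat.{v} Rᵐᵒᵖ} {M' : ModuleCat.{v} Sᵐᵒᵖ}
    (f : M ⟶ (ModuleCat.restrictScalars φ.op).obj M')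
    {N : ModuleCat.{v} R} {N' : ModuleCat.{v} S}
    (g : N ⟶ (ModuleCat.restrictScalars φ).obj N') :
    (tensorFunctor M).obj N ⟶ (tensorFunctor M').obj N' :=
  AddCommGrpCat.ofHom
    (TensorOver.map φ (N' := N') (M' := M') f.hom.toAddMonoidHom g.hom.toAddMonoidHom
      (fun r m ↦ f.hom.map_smul (MulOpposite.op r) m) (fun r n ↦ g.hom.map_smul r n))

/-- The chain map `M ⊗_R P → M' ⊗_S Q` induced by a `φ`-semilinear map `f : M → M'` and a
`φ`-semilinear chain map `h : P → Q`. -/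
def tensorChain (φ : R →+* S) {M : ModuleCat.{v} Rᵐᵒᵖ} {M' : ModuleCat.{v} Sᵐᵒᵖ}
    (f : M ⟶ (ModuleCat.restrictScalars φ.op).obj M')
    {P : ChainComplex (ModuleCat.{v} R) ℕ} {Q : ChainComplex (ModuleCat.{v} S) ℕ}
    (h : P ⟶ resComplex φ Q) :
    ((tensorFunctor M).mapHomologicalComplex _).obj P ⟶
      ((tensorFunctor M').mapHomologicalComplex _).obj Q where
  f n := tensorChange φ f (h.f n)
  comm' i j _ := by
    ext1
    refine TensorOver.hom_ext fun m n ↦ ?_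
    exact congrArg (TensorOver.tmul S (M := M') (N := Q.X j) (f.hom m))
      (ConcreteCategory.congr_hom (h.comm i j) n)

/-- For `φ : R → S`, projective resolutions `P` of `N` over `R` and `Q` of `N'` over `S`, and a
`φ`-semilinear map `g : N → N'`, the property that the `φ`-semilinear chain map `h : P → Q`
covers `g`. -/
def Covers (φ : R →+* S) {N : ModuleCat.{v} R} {N' : ModuleCat.{v} S}
    (g : N ⟶ (ModuleCat.restrictScalars φ).obj N')
    (P : ProjectiveResolution N) (Q : ProjectiveResolution N')
    (h : P.complex ⟶ resComplex φ Q.complex) : Prop :=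
  h.f 0 ≫ (ModuleCat.restrictScalars φ).map (Q.π.f 0) = P.π.f 0 ≫ g

section

variable (φ : R →+* S) {N : ModuleCat.{v} R} {N' : ModuleCat.{v} S}
    (g : N ⟶ (ModuleCat.restrictScalars φ).obj N')
    (P : ProjectiveResolution N) (Q : ProjectiveResolution N')

theorem res_exact (n : ℕ) : (ShortComplex.mk _ _
    ((resComplex φ Q.complex).d_comp_d (n + 2) (n + 1) n)).Exact := by
  have h := (ShortComplex.moduleCat_exact_iff _).1 (Q.exact_succ n)
  exact (ShortComplex.moduleCat_exact_iff _).2 h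

theorem res_w : (resComplex φ Q.complex).d 1 0 ≫
    (ModuleCat.restrictScalars φ).map (Q.π.f 0) = 0 := by
  change (ModuleCat.restrictScalars φ).map (Q.complex.d 1 0) ≫ _ = 0
  rw [← Functor.map_comp, Q.complex_d_comp_π_f_zero, Functor.map_zero]

theorem res_exact₀ : (ShortComplex.mk _ _ (res_w φ Q)).Exact := by
  have h := (ShortComplex.moduleCat_exact_iff _).1 Q.exact₀
  exact (ShortComplex.moduleCat_exact_iff _).2 h

theorem epi_π : Epi (Q.π.f 0) := inferInstance

theorem exists_covers : ∃ h : P.complex ⟶ resComplex φ Q.complex, Covers φ g P Q h := by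
  have : Epi ((ModuleCat.restrictScalars φ).map (Q.π.f 0)) := by
    have h := (ModuleCat.epi_iff_surjective (Q.π.f 0)).1 (epi_π Q)
    exact (ModuleCat.epi_iff_surjective _).2 h
  exact exists_lift P _ _ this (res_w φ Q) (res_exact₀ φ Q) (res_exact φ Q) g

variable {φ g P Q}

theorem Covers.nonempty_homotopy {h h' : P.complex ⟶ resComplex φ Q.complex}
    (hh : Covers φ g P Q h) (hh' : Covers φ g P Q h') : Nonempty (Homotopy h h') :=
  ProTor.nonempty_homotopy P _ _ (res_w φ Q) (res_exact₀ φ Q) (res_exact φ Q) h h'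
    (hh.trans hh'.symm)

/-- Homotopic semilinear chain maps induce the same map in homology after tensoring. -/
theorem Covers.homologyMap_eq {M : ModuleCat.{v} Rᵐᵒᵖ} {M' : ModuleCat.{v} Sᵐᵒᵖ}
    (f : M ⟶ (ModuleCat.restrictScalars φ.op).obj M')
    {h h' : P.complex ⟶ resComplex φ Q.complex}
    (hh : Covers φ g P Q h) (hh' : Covers φ g P Q h') (q : ℕ) :
    HomologicalComplex.homologyMap (tensorChain φ f h) q =
      HomologicalComplex.homologyMap (tensorChain φ f h') q := by
  obtain ⟨s⟩ := hh.nonempty_homotopy hh'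
  have key : ∀ h : P.complex ⟶ resComplex φ Q.complex, tensorChain φ f h =
      ((tensorFunctor M).mapHomologicalComplex _).map h ≫
        tensorChain φ f (𝟙 (resComplex φ Q.complex)) := fun h ↦ by
    ext n : 2
    exact TensorOver.hom_ext fun _ _ ↦ rfl
  rw [key h, key h']
  exact (((tensorFunctor M).mapHomotopy s).compRight _).homologyMap_eq q

end

/-- Two composable semilinear chain maps that cover maps of modules compose to a
semilinear chain map that covers the composite. -/
theorem exists_covers_comp {φ : R →+* S} {ψ : S →+* T} {χ : R →+* T} (hχ : χ = ψ.comp φ)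
    {M : ModuleCat.{v} Rᵐᵒᵖ} {M' : ModuleCat.{v} Sᵐᵒᵖ} {M'' : ModuleCat.{v} Tᵐᵒᵖ}
    {f : M ⟶ (ModuleCat.restrictScalars φ.op).obj M'}
    {f' : M' ⟶ (ModuleCat.restrictScalars ψ.op).obj M''}
    {f'' : M ⟶ (ModuleCat.restrictScalars χ.op).obj M''}
    (hf : ∀ x, f''.hom x = f'.hom (f.hom x))
    {N : ModuleCat.{v} R} {N' : ModuleCat.{v} S} {N'' : ModuleCat.{v} T}
    {g : N ⟶ (ModuleCat.restrictScalars φ).obj N'}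
    {g' : N' ⟶ (ModuleCat.restrictScalars ψ).obj N''}
    {g'' : N ⟶ (ModuleCat.restrictScalars χ).obj N''}
    (hg : ∀ x, g''.hom x = g'.hom (g.hom x))
    {P : ProjectiveResolution N} {P' : ProjectiveResolution N'} {P'' : ProjectiveResolution N''}
    {h : P.complex ⟶ resComplex φ P'.complex} (hh : Covers φ g P P' h)
    {h' : P'.complex ⟶ resComplex ψ P''.complex} (hh' : Covers ψ g' P' P'' h') :
    ∃ h'' : P.complex ⟶ resComplex χ P''.complex, Covers χ g'' P P'' h'' ∧
      tensorChain χ f'' h'' = tensorChain φ f h ≫ tensorChain ψ f' h' := by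
  let e := ModuleCat.restrictScalarsComp' φ ψ χ hχ
  refine ⟨h ≫ ((ModuleCat.restrictScalars φ).mapHomologicalComplex _).map h' ≫
    (NatTrans.mapHomologicalComplex e.inv _).app P''.complex, ?_, ?_⟩
  · ext x
    have h1 := ConcreteCategory.congr_hom hh x
    have h2 := ConcreteCategory.congr_hom hh' ((h.f 0).hom x)
    exact h2.trans ((congrArg g'.hom h1).trans (hg _).symm)
  · ext n : 2
    refine TensorOver.hom_ext fun m x ↦ ?_
    exact congrArg (fun y ↦ TensorOver.tmul T (M := M'') (N := P''.complex.X n) y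
      ((h'.f n).hom ((h.f n).hom x))) (hf m)

variable [Small.{v} R] [Small.{v} S] [Small.{v} T]

/-- The map `Tor_q^R(M, N) → Tor_q^S(M', N')` induced by a ring homomorphism `φ : R → S` and
`φ`-semilinear maps `f : M → M'` and `g : N → N'`: choose projective resolutions `P` of `N` over
`R` and `Q` of `N'` over `S`, extend `g` to a `φ`-semilinear chain map `h : P → Q`, and take the
map that `f ⊗ h : M ⊗_R P → M' ⊗_S Q` induces in homology. -/
def torMap (φ : R →+* S) {M : ModuleCat.{v} Rᵐᵒᵖ} {M' : ModuleCat.{v} Sᵐᵒᵖ}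
    (f : M ⟶ (ModuleCat.restrictScalars φ.op).obj M')
    {N : ModuleCat.{v} R} {N' : ModuleCat.{v} S}
    (g : N ⟶ (ModuleCat.restrictScalars φ).obj N') (q : ℕ) :
    tor M N q ⟶ tor M' N' q :=
  ((projectiveResolution N).isoLeftDerivedObj (tensorFunctor M) q).hom ≫
    HomologicalComplex.homologyMap
      (tensorChain φ f
        (exists_covers φ g (projectiveResolution N) (projectiveResolution N')).choose) q ≫
    ((projectiveResolution N').isoLeftDerivedObj (tensorFunctor M') q).inv

theorem comp_aux {C : Type*} [Category* C] {X X' Y Y' Z Z' : C} (a : X ⟶ X') (b : X' ⟶ Y')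
    (e : Y ≅ Y') (c : Y' ⟶ Z') (d : Z' ⟶ Z) :
    a ≫ (b ≫ c) ≫ d = (a ≫ b ≫ e.inv) ≫ e.hom ≫ c ≫ d := by
  simp

theorem torMap_comp {φ : R →+* S} {ψ : S →+* T} {χ : R →+* T} (hχ : χ = ψ.comp φ)
    {M : ModuleCat.{v} Rᵐᵒᵖ} {M' : ModuleCat.{v} Sᵐᵒᵖ} {M'' : ModuleCat.{v} Tᵐᵒᵖ}
    (f : M ⟶ (ModuleCat.restrictScalars φ.op).obj M')
    (f' : M' ⟶ (ModuleCat.restrictScalars ψ.op).obj M'')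
    (f'' : M ⟶ (ModuleCat.restrictScalars χ.op).obj M'')
    (hf : ∀ x, f''.hom x = f'.hom (f.hom x))
    {N : ModuleCat.{v} R} {N' : ModuleCat.{v} S} {N'' : ModuleCat.{v} T}
    (g : N ⟶ (ModuleCat.restrictScalars φ).obj N')
    (g' : N' ⟶ (ModuleCat.restrictScalars ψ).obj N'')
    (g'' : N ⟶ (ModuleCat.restrictScalars χ).obj N'')
    (hg : ∀ x, g''.hom x = g'.hom (g.hom x)) (q : ℕ) :
    torMap χ f'' g'' q = torMap φ f g q ≫ torMap ψ f' g' q := by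
  let P := projectiveResolution N
  let P' := projectiveResolution N'
  let P'' := projectiveResolution N''
  obtain ⟨h'', hh'', hc⟩ := exists_covers_comp hχ hf hg
    (exists_covers φ g P P').choose_spec (exists_covers ψ g' P' P'').choose_spec
  unfold torMap
  rw [Covers.homologyMap_eq f'' (exists_covers χ g'' P P'').choose_spec hh'' q, hc,
    HomologicalComplex.homologyMap_comp]
  exact comp_aux _ _ _ _ _

theorem torMap_id {φ : R →+* R} (hφ : φ = RingHom.id R) {M : ModuleCat.{v} Rᵐᵒᵖ}
    (f : M ⟶ (ModuleCat.restrictScalars φ.op).obj M) (hf : ∀ x, f.hom x = x)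
    {N : ModuleCat.{v} R} (g : N ⟶ (ModuleCat.restrictScalars φ).obj N)
    (hg : ∀ x, g.hom x = x) (q : ℕ) :
    torMap φ f g q = 𝟙 _ := by
  let P := projectiveResolution N
  let e := ModuleCat.restrictScalarsId' φ hφ
  let h : P.complex ⟶ resComplex φ P.complex :=
    { f := fun n ↦ e.inv.app (P.complex.X n)
      comm' := fun i j _ ↦ (e.inv.naturality (P.complex.d i j)).symm }
  have hh : Covers φ g P P h := by
    ext x
    exact (hg _).symm
  have hc : tensorChain φ f h = 𝟙 _ := by
    ext n : 2
    refine TensorOver.hom_ext fun m x ↦ ?_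
    exact congrArg (fun y ↦ TensorOver.tmul R (M := M) (N := P.complex.X n) y x) (hf m)
  unfold torMap
  rw [Covers.homologyMap_eq f (exists_covers φ g P P).choose_spec hh q, hc,
    HomologicalComplex.homologyMap_id]
  exact (congrArg _ (Category.id_comp _)).trans (Iso.hom_inv_id _)

end ChangeOfRings

/-! ### The ring `ℤ ⋉ A` -/

section Unitization

variable {A B C : Type u} [NonUnitalRing A] [NonUnitalRing B] [NonUnitalRing C]

variable (A) in
/-- The ring `ℤ ⋉ A` of a ring `A` without unit: the additive group `ℤ × A` with the product
`(a, x) (a', x') = (a a', a x' + a' x + x x')`. -/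
def ZSemi : Type u := Unitization ℤ A

instance : Ring (ZSemi A) := inferInstanceAs (Ring (Unitization ℤ A))

/-- The ring homomorphism `ℤ ⋉ A → ℤ ⋉ B`, `(a, x) ↦ (a, f x)`. -/
def semiMap (f : A →ₙ+* B) : ZSemi A →+* ZSemi B where
  toFun x := Unitization.mk (x.toProd.1, f x.toProd.2)
  map_one' := Unitization.ext rfl (map_zero f)
  map_zero' := Unitization.ext rfl (map_zero f)
  map_add' x y := Unitization.ext rfl (map_add f _ _)
  map_mul' x y := Unitization.ext rfl (by
    change f (x.toProd.1 • y.toProd.2 + y.toProd.1 • x.toProd.2 + x.toProd.2 * y.toProd.2) =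
      x.toProd.1 • f y.toProd.2 + y.toProd.1 • f x.toProd.2 + f x.toProd.2 * f y.toProd.2
    simp)

variable (A) in
/-- The augmentation `ℤ ⋉ A → ℤ`, `(a, x) ↦ a`. -/
def augmentation : ZSemi A →+* ℤ where
  toFun x := x.toProd.1
  map_one' := rfl
  map_zero' := rfl
  map_add' _ _ := rfl
  map_mul' _ _ := rfl

variable (A) in
/-- The augmentation of the opposite ring of `ℤ ⋉ A`. -/
def augmentationOp : (ZSemi A)ᵐᵒᵖ →+* ℤ :=
  (augmentation A).fromOpposite fun _ _ ↦ Commute.all _ _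

variable (A) in
/-- `ℤ` as a left `ℤ ⋉ A`-module through the augmentation. -/
def leftZ : ModuleCat.{u} (ZSemi A) :=
  (ModuleCat.restrictScalars (augmentation A)).obj (ModuleCat.of ℤ (ULift.{u} ℤ))

variable (A) in
/-- `ℤ` as a right `ℤ ⋉ A`-module through the augmentation. -/
def rightZ : ModuleCat.{u} (ZSemi A)ᵐᵒᵖ :=
  (ModuleCat.restrictScalars (augmentationOp A)).obj (ModuleCat.of ℤ (ULift.{u} ℤ))

/-- The identity map of `ℤ` as a semilinear map of left modules. -/
def leftZMap (f : A →ₙ+* B) :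
    leftZ A ⟶ (ModuleCat.restrictScalars (semiMap f)).obj (leftZ B) :=
  (ModuleCat.restrictScalarsComp'App (semiMap f) (augmentation B) (augmentation A)
    rfl _).hom

/-- The identity map of `ℤ` as a semilinear map of right modules. -/
def rightZMap (f : A →ₙ+* B) :
    rightZ A ⟶ (ModuleCat.restrictScalars (semiMap f).op).obj (rightZ B) :=
  (ModuleCat.restrictScalarsComp'App (semiMap f).op (augmentationOp B) (augmentationOp A)
    rfl _).hom

variable (A) in
/-- The abelian group `Tor_q^{ℤ ⋉ A}(ℤ, ℤ)`. -/
def torZ (q : ℕ) : AddCommGrpCat.{u} :=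
  tor (rightZ A) (leftZ A) q

/-- The map `Tor_q^{ℤ ⋉ A}(ℤ, ℤ) → Tor_q^{ℤ ⋉ B}(ℤ, ℤ)` induced by `f : A → B`. -/
def torZMap (f : A →ₙ+* B) (q : ℕ) : torZ A q ⟶ torZ B q :=
  torMap (semiMap f) (rightZMap f) (leftZMap f) q

theorem semiMap_id (f : A →ₙ+* A) (hf : ∀ x, f x = x) : semiMap f = RingHom.id (ZSemi A) :=
  RingHom.ext fun x ↦ Unitization.ext (x := semiMap f x) (y := x) rfl (hf x.toProd.2)

theorem semiMap_comp (f : A →ₙ+* B) (g : B →ₙ+* C) (k : A →ₙ+* C)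
    (h : ∀ x, k x = g (f x)) : semiMap k = (semiMap g).comp (semiMap f) :=
  RingHom.ext fun x ↦ Unitization.ext (x := semiMap k x) (y := semiMap g (semiMap f x))
    rfl (h x.toProd.2)

theorem torZMap_id (f : A →ₙ+* A) (hf : ∀ x, f x = x) (q : ℕ) : torZMap f q = 𝟙 _ :=
  torMap_id (semiMap_id f hf) (rightZMap f) (fun _ ↦ rfl) (leftZMap f) (fun _ ↦ rfl) q

theorem torZMap_comp (f : A →ₙ+* B) (g : B →ₙ+* C) (k : A →ₙ+* C)
    (h : ∀ x, k x = g (f x)) (q : ℕ) : torZMap k q = torZMap f q ≫ torZMap g q :=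
  torMap_comp (semiMap_comp f g k h) (rightZMap f) (rightZMap g) (rightZMap k) (fun _ ↦ rfl)
    (leftZMap f) (leftZMap g) (leftZMap k) (fun _ ↦ rfl) q

end Unitization

/-! ### Pro-objects -/

section Pro

/-- A pro-object `X = {X_s}` indexed by a directed set `J`, in a category with zero morphisms, is
zero if for every `s` there is `s' ≥ s` such that `X_{s'} → X_s` is the zero map. -/
def IsZeroPro {J : Type*} [Preorder J] [IsDirectedOrder J] {C : Type*} [Category* C]
    [Limits.HasZeroMorphisms C] (X : Jᵒᵖ ⥤ C) : Prop :=
  ∀ s : J, ∃ (s' : J) (h : s ≤ s'), X.map (homOfLE h).op = 0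

variable {F : Type u} [Ring F]

/-- The inclusion of ideals, regarded as rings without unit. -/
def idealInclusion {J K : Ideal F} (h : J ≤ K) : J →ₙ+* K where
  toFun x := ⟨x.1, h x.2⟩
  map_mul' _ _ := rfl
  map_zero' := rfl
  map_add' _ _ := rfl

theorem pow_le_pow (I : Ideal F) [I.IsTwoSided] {m n : ℕ+} (h : m ≤ n) :
    I ^ (n : ℕ) ≤ I ^ (m : ℕ) :=
  Ideal.pow_le_pow_right h

/-- The pro-abelian group `{Tor_q^{ℤ ⋉ I^m}(ℤ, ℤ)}`, indexed by the positive integers `m`, with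
structure maps induced by the inclusions `I^n ⊆ I^m`, `n ≥ m`. -/
def proTor (I : Ideal F) [I.IsTwoSided] (q : ℕ) : ℕ+ᵒᵖ ⥤ AddCommGrpCat.{u} where
  obj m := torZ (I ^ (m.unop : ℕ) : Ideal F) q
  map f := torZMap (idealInclusion (pow_le_pow I f.unop.le)) q
  map_id _ := torZMap_id _ (fun _ ↦ rfl) q
  map_comp _ _ := torZMap_comp _ _ _ (fun _ ↦ rfl) q

end Pro

end ProTor

end

/-! Take `m' = 2m` for every `q`, and put `J = I ^ m`. Left ideals of a free algebra over a field
are projective (`FreeAlgebra.projective_ideal`), so each element of `J` can be written linearly as a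
combination `∑ cᵢ wᵢ` with `wᵢ ∈ J` and `cᵢ ∈ F`. On `J * J` the coefficients lie in `J`, because
`J` is also a right ideal. Hence the inclusion `J * J → J` factors through a direct sum of copies of
`J`, followed by right multiplications by elements of `J`.

By `ProTor.torZMap_eq_zero` such a factorization kills `Tor_q` for `q > 0`: it gives a chain map
between resolutions that covers the identity of `ℤ`, vanishes in degrees at least 2, and in degree 1
has image in the augmentation ideal times the target, which dies after tensoring with `ℤ`. -/

/-! ### Projectivity of left ideals in free algebras. -/

/-- A left ideal of an algebra over a field has a linear retraction. -/
theorem Ideal.exists_linearMap_apply_coe (k : Type*) [Field k] {R : Type*} [Ring R] [Algebra k R]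
    (J : Ideal R) : ∃ r : R →ₗ[k] J, ∀ j : J, r j = j := by
  obtain ⟨r, hr⟩ := (J.restrictScalars k).subtype.exists_leftInverse_of_injective
    (Submodule.ker_subtype _)
  exact ⟨r, LinearMap.congr_fun hr⟩

open scoped TensorProduct in
/-- Left ideals of a free algebra over a field are projective modules. -/
theorem FreeAlgebra.projective_ideal {k : Type*} [Field k] {X : Type*}
    (J : Ideal (FreeAlgebra k X)) : Module.Projective (FreeAlgebra k X) J := by
  let M := FreeAlgebra k X ⊗[k] J
  obtain ⟨r, hr⟩ := J.exists_linearMap_apply_coe k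
  let i : J →ₗ[k] M := TensorProduct.mk k (FreeAlgebra k X) J 1
  -- `c x` records the failure of the retraction `r` to commute with left multiplication by `x`.
  let c (x : X) : FreeAlgebra k X →ₗ[k] M := i ∘ₗ (r ∘ₗ LinearMap.mulLeft k (FreeAlgebra.ι k x) -
    DistribSMul.toLinearMap k J (FreeAlgebra.ι k x) ∘ₗ r)
  -- By freeness, any operators assigned to the generators define an action. This one makes the
  -- product an extension of the left module `FreeAlgebra k X` by `M`, twisted by `c`.
  let Φ : FreeAlgebra k X →ₐ[k] Module.End k (FreeAlgebra k X × M) := FreeAlgebra.lift k fun x ↦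
    (LinearMap.mulLeft k (FreeAlgebra.ι k x) ∘ₗ LinearMap.fst k (FreeAlgebra k X) M).prod
      (DistribSMul.toLinearMap k M (FreeAlgebra.ι k x) ∘ₗ LinearMap.snd k (FreeAlgebra k X) M +
        c x ∘ₗ LinearMap.fst k (FreeAlgebra k X) M)
  have hΦ (x : X) (v : FreeAlgebra k X × M) : Φ (FreeAlgebra.ι k x) v =
      (FreeAlgebra.ι k x * v.1, FreeAlgebra.ι k x • v.2 +
        i (r (FreeAlgebra.ι k x * v.1) - FreeAlgebra.ι k x • r v.1)) :=
    LinearMap.congr_fun (FreeAlgebra.lift_ι_apply (R := k) _ x) v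
  have h₁ (a : FreeAlgebra k X) : ∀ v, (Φ a v).1 = a * v.1 := by
    induction a using FreeAlgebra.induction with
    | grade0 z => intro v; rw [AlgHom.commutes]; exact Algebra.smul_def _ _
    | grade1 x => intro v; rw [hΦ]
    | mul a b ha hb => intro v; rw [map_mul, Module.End.mul_apply, ha, hb, mul_assoc]
    | add a b ha hb => intro v; rw [map_add, LinearMap.add_apply, Prod.fst_add, ha, hb, add_mul]
  -- The starting vector satisfies `μ v.2 = r v.1`, the relation that `h₂` propagates; so `μ (T a) =
  -- r a`.
  let T (a : FreeAlgebra k X) : M := (Φ a (1, i (r 1))).2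
  let μ : M →ₗ[FreeAlgebra k X] J := TensorProduct.AlgebraTensorModule.lift
    (LinearMap.toSpanSingleton (FreeAlgebra k X) (J →ₗ[k] J) LinearMap.id)
  have hμi (j : J) : μ (i j) = j := one_smul (FreeAlgebra k X) j
  have h₂ (a : FreeAlgebra k X) : ∀ v, μ v.2 = r v.1 → μ (Φ a v).2 = r (Φ a v).1 := by
    induction a using FreeAlgebra.induction with
    | grade0 z =>
      intro v hv
      simp only [AlgHom.commutes, Module.algebraMap_end_apply, Prod.smul_snd, Prod.smul_fst,
        map_smul, ← hv]
      exact μ.map_smul_of_tower z v.2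
    | grade1 x =>
      intro v hv
      rw [hΦ, map_add, μ.map_smul, hμi, hv]
      abel
    | mul a b ha hb => intro v hv; rw [map_mul]; exact ha _ (hb _ hv)
    | add a b ha hb =>
      intro v hv
      rw [map_add, LinearMap.add_apply, Prod.snd_add, map_add, Prod.fst_add, map_add, ha _ hv,
        hb _ hv]
  -- Since `r` is the identity on `J`, the twist vanishes there. This makes `T` linear on `J`,
  -- although it need not be so on the whole algebra.
  have h₃ (a : FreeAlgebra k X) : ∀ v : FreeAlgebra k X × M, v.1 ∈ J → (Φ a v).2 = a • v.2 := by
    induction a using FreeAlgebra.induction with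
    | grade0 z => intro v _; simp
    | grade1 x =>
      intro v hv
      rw [hΦ, hr ⟨v.1, hv⟩, hr ⟨_, J.mul_mem_left (FreeAlgebra.ι k x) hv⟩]
      have : (⟨_, J.mul_mem_left (FreeAlgebra.ι k x) hv⟩ : J) -
        FreeAlgebra.ι k x • (⟨v.1, hv⟩ : J) = 0 := sub_self _
      rw [this, map_zero, add_zero]
    | mul a b ha hb =>
      intro v hv
      rw [map_mul, Module.End.mul_apply, ha _ (by rw [h₁]; exact J.mul_mem_left _ hv), hb _ hv,
        mul_smul]
    | add a b ha hb =>
      intro v hv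
      rw [map_add, LinearMap.add_apply, Prod.snd_add, ha _ hv, hb _ hv, add_smul]
  let σ : J →ₗ[FreeAlgebra k X] M :=
    { toFun j := T j
      map_add' j j' := by simp [T]
      map_smul' a j := by
        simp only [T, smul_eq_mul, Submodule.coe_smul, map_mul, Module.End.mul_apply,
          RingHom.id_apply]
        exact h₃ a _ (by rw [h₁, mul_one]; exact j.2) }
  -- `J` is free over the field `k`, so its base change `M` is free.
  have : Module.Projective (FreeAlgebra k X) M := inferInstance
  refine Module.Projective.of_split σ μ (LinearMap.ext fun j ↦ ?_)
  refine (h₂ j _ (hμi _)).trans ?_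
  rw [h₁, mul_one]
  exact hr j

/-! ### A vanishing criterion for maps on Tor. -/

namespace ProTor

variable {A B : Type u} [NonUnitalRing A] [NonUnitalRing B]

variable (A) in
/-- The augmentation as a map of left modules from the free module of rank one. -/
noncomputable def augmentationHom : ModuleCat.of (ZSemi A) (ZSemi A) ⟶ leftZ A :=
  ModuleCat.ofHom (Y := leftZ A)
    { toFun x := ULift.up (augmentation A x)
      map_add' x y := congrArg ULift.up (map_add (augmentation A) x y)
      map_smul' r x := congrArg ULift.up (map_mul (augmentation A) r x) }

instance : Epi (augmentationHom A) := (ModuleCat.epi_iff_surjective _).2 fun z ↦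
  ⟨Unitization.mk (ULift.down z, 0), rfl⟩

/-- The inclusion of `A` in `ℤ ⋉ A`. -/
def inclusion : A →+ ZSemi A where
  toFun a := Unitization.mk (0, a)
  map_zero' := rfl
  map_add' _ _ := Unitization.ext (add_zero 0).symm rfl

/-- The projection of `ℤ ⋉ A` to `A`. -/
def projection : ZSemi A →+ A where
  toFun x := x.toProd.2
  map_zero' := rfl
  map_add' _ _ := rfl

/-- The right side uses only sums, integer multiples and products by `f (projection r)`, the
operations with which the map `s` of `torZMap_eq_zero` is compatible. -/
theorem semiMap_mul_inclusion (f : A →ₙ+* B) (r : ZSemi A) (b : B) :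
    semiMap f r * inclusion b = inclusion (augmentation A r • b + f (projection r) * b) :=
  Unitization.ext (mul_zero (augmentation A r)) (by
    change augmentation A r • b + (0 : ℤ) • f (projection r) + f (projection r) * b = _
    rw [zero_smul, add_zero]
    rfl)

theorem semiMap_inclusion (f : A →ₙ+* B) (a : A) : semiMap f (inclusion a) = inclusion (f a) :=
  rfl

theorem inclusion_mul_inclusion (a b : A) :
    (inclusion a * inclusion b : ZSemi A) = inclusion (a * b) :=
  (Unitization.inr_mul ℤ a b).symm

theorem inclusion_projection {x : ZSemi A} (hx : augmentation A x = 0) :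
    inclusion (projection x) = x :=
  Unitization.ext hx.symm rfl

theorem projection_mul {x : ZSemi A} (hx : augmentation A x = 0) (r : ZSemi A) :
    projection (r * x) = augmentation A r • projection x + projection r * projection x := by
  change augmentation A r • projection x + augmentation A x • projection r +
    projection r * projection x = _
  rw [hx, zero_smul, add_zero]

/-- Moving `inclusion a` across the tensor sign makes it act on `ℤ` through the augmentation, hence
by zero. -/
theorem tensorOver_tmul_inclusion_smul {M : Type*} [AddCommGroup M] [Module (ZSemi A) M]
    (z : rightZ A) (a : A) (m : M) : TensorOver.tmul (ZSemi A) z (inclusion a • m) = 0 := by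
  rw [← TensorOver.smul_tmul, show MulOpposite.op (inclusion a) • z = 0 from
    congrArg ULift.up (zero_mul (ULift.down z))]
  exact congrArg (QuotientAddGroup.mk' (balancing (ZSemi A) (rightZ A) M))
    (TensorProduct.zero_tmul _ m)

theorem homologyMap_eq_zero {K L : ChainComplex AddCommGrpCat.{u} ℕ} (h : K ⟶ L) {q : ℕ}
    (hq : h.f q = 0) : HomologicalComplex.homologyMap h q = 0 := by
  rw [← cancel_epi (K.homologyπ q), HomologicalComplex.homologyπ_naturality,
    Limits.comp_zero]
  have : HomologicalComplex.cyclesMap h q = 0 := by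
    rw [← cancel_mono (L.iCycles q), HomologicalComplex.cyclesMap_i, hq, Limits.comp_zero,
      Limits.zero_comp]
  rw [this, Limits.zero_comp]

/-- If `f : A → B` factors as `A → ⨁_W B → B`, where the first map is compatible with left
multiplication by `A` and the second one multiplies the summand at `i` by `w i` on the right, then
`f` induces the zero map on `Tor_q` for `q > 0`. -/
theorem torZMap_eq_zero (f : A →ₙ+* B) {W : Type*} (s : A →+ (W →₀ B)) (w : W → B)
    (hs : ∀ a a' i, s (a * a') i = f a * s a' i)
    (hw : ∀ a, ((s a).sum fun i b ↦ b * w i) = f a) {q : ℕ} (hq : 0 < q) :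
    torZMap f q = 0 := by
  let P := projectiveResolution (leftZ A)
  let Q := projectiveResolution (leftZ B)
  let πP : P.complex.X 0 ⟶ leftZ A := P.π.f 0
  let πQ : Q.complex.X 0 ⟶ leftZ B := Q.π.f 0
  obtain ⟨u, hu⟩ : ∃ u : P.complex.X 0 ⟶ ModuleCat.of (ZSemi A) (ZSemi A),
      u ≫ augmentationHom A = πP :=
    ⟨Projective.factorThru πP (augmentationHom A), Projective.factorThru_comp _ _⟩
  obtain ⟨e, he⟩ : ∃ e, πQ.hom e = ULift.up 1 :=
    (ModuleCat.epi_iff_surjective (Q.π.f 0)).1 inferInstance (ULift.up 1)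
  -- `inclusion (w i)` has augmentation zero, so `inclusion (w i) • e` is a cycle and therefore a
  -- boundary.
  have hlift (i : W) : ∃ y : Q.complex.X 1, (Q.complex.d 1 0).hom y = inclusion (w i) • e := by
    refine (ShortComplex.moduleCat_exact_iff _).1 Q.exact₀ (inclusion (w i) • e) ?_
    refine (πQ.hom.map_smul _ _).trans ?_
    rw [he]
    exact congrArg ULift.up (zero_mul 1)
  choose y hy using hlift
  let h₀ : P.complex.X 0 ⟶ (ModuleCat.restrictScalars (semiMap f)).obj (Q.complex.X 0) :=
    ModuleCat.ofHom (Y := (ModuleCat.restrictScalars (semiMap f)).obj (Q.complex.X 0))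
      { toFun x := (semiMap f (u.hom x) • e : Q.complex.X 0)
        map_add' x x' := by
          rw [map_add, map_add]
          exact add_smul _ _ e
        map_smul' r x := by
          rw [map_smul, smul_eq_mul, map_mul]
          exact mul_smul _ _ e }
  have hd (x) : augmentation A (u.hom ((P.complex.d 1 0).hom x)) = 0 := by
    have h := ConcreteCategory.congr_hom P.complex_d_comp_π_f_zero x
    exact congrArg ULift.down ((ConcreteCategory.congr_hom hu _).trans h)
  -- The differential followed by `u` lands in the augmentation ideal, which is identified with `A`.
  let v : P.complex.X 1 →+ A :=
    projection.comp ((P.complex.d 1 0 ≫ u).hom.toAddMonoidHom)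
  have hv (x) : inclusion (v x) = (u.hom ((P.complex.d 1 0).hom x) : ZSemi A) :=
    inclusion_projection (hd x)
  have hvs (r : ZSemi A) (x) : v (r • x) = augmentation A r • v x + projection r * v x :=
    (congrArg projection ((P.complex.d 1 0 ≫ u).hom.map_smul r x)).trans (projection_mul (hd x) r)
  let g : (W →₀ B) →+ Q.complex.X 1 :=
    Finsupp.liftAddHom fun i ↦ ((smulAddHom (ZSemi B) (Q.complex.X 1)).flip (y i)).comp inclusion
  have hg_apply (c : W →₀ B) : g c = c.sum fun i b ↦ inclusion b • y i := rfl
  have hg (r : ZSemi A) (a : A) :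
      g (s (augmentation A r • a + projection r * a)) = semiMap f r • g (s a) := by
    have hc (i) : s (augmentation A r • a + projection r * a) i =
        augmentation A r • s a i + f (projection r) * s a i := by
      rw [map_add, map_zsmul, Finsupp.add_apply, hs, Finsupp.smul_apply]
    -- Acting by `r` may shrink the support, so both sums are taken over that of `s a`.
    rw [hg_apply, hg_apply, Finsupp.sum_of_support_subset (s := (s a).support), Finsupp.sum,
      Finset.smul_sum]
    · refine Finset.sum_congr rfl fun i _ ↦ ?_
      rw [hc, ← mul_smul, semiMap_mul_inclusion]
    · intro i hi
      rw [Finsupp.mem_support_iff] at hi ⊢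
      contrapose! hi
      rw [hc, hi, smul_zero, mul_zero, add_zero]
    · intro i _
      rw [map_zero, zero_smul]
  have hg_tmul (z : rightZ B) (c : W →₀ B) : TensorOver.tmul (ZSemi B) z (g c) = 0 := by
    induction c using Finsupp.induction_linear with
    | zero =>
      rw [map_zero, ← zero_smul (ZSemi B) (0 : Q.complex.X 1), ← map_zero inclusion]
      exact tensorOver_tmul_inclusion_smul _ _ _
    | add c c' hc hc' => rw [map_add, TensorOver.tmul_add, hc, hc', add_zero]
    | single i b =>
      rw [hg_apply, Finsupp.sum_single_index (by rw [map_zero, zero_smul])]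
      exact tensorOver_tmul_inclusion_smul _ _ _
  let h₁ : P.complex.X 1 ⟶ (ModuleCat.restrictScalars (semiMap f)).obj (Q.complex.X 1) :=
    ModuleCat.ofHom (Y := (ModuleCat.restrictScalars (semiMap f)).obj (Q.complex.X 1))
      { toFun x := g (s (v x))
        map_add' x x' := by
          rw [map_add, map_add, map_add]
          rfl
        map_smul' r x := by
          rw [hvs, hg]
          rfl }
  have hd₁ (x) : (Q.complex.d 1 0).hom (g (s (v x))) =
      semiMap f (u.hom ((P.complex.d 1 0).hom x)) • e := by
    rw [← hv, semiMap_inclusion, ← hw, hg_apply, map_finsuppSum, map_finsuppSum,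
      Finsupp.sum, Finsupp.sum, Finset.sum_smul]
    refine Finset.sum_congr rfl fun i _ ↦ ?_
    rw [map_smul, hy, ← mul_smul, inclusion_mul_inclusion]
  -- `h₁` factors through `P.complex.d 1 0`; this is what allows the zero map from degree 2 on.
  have hd₂ : P.complex.d 2 1 ≫ h₁ = 0 := by
    ext x
    have : v ((P.complex.d 2 1).hom x) = 0 :=
      congrArg (fun z ↦ projection (u.hom z))
        (ConcreteCategory.congr_hom (P.complex.d_comp_d 2 1 0) x) |>.trans (by
          change projection (u.hom 0) = 0
          rw [map_zero]
          rfl)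
    change g (s (v ((P.complex.d 2 1).hom x))) = 0
    rw [this, map_zero, map_zero]
  let h : P.complex ⟶ resComplex (semiMap f) Q.complex :=
    { f := fun
        | 0 => h₀
        | 1 => h₁
        | _ + 2 => 0
      comm' := by
        rintro _ j rfl
        match j with
        | 0 => ext x; exact hd₁ x
        | 1 => exact Limits.zero_comp.trans hd₂.symm
        | _ + 2 => exact Limits.zero_comp.trans Limits.comp_zero.symm }
  have hh : Covers (semiMap f) (leftZMap f) P Q h := by
    ext x
    refine (πQ.hom.map_smul _ _).trans ?_
    rw [he]
    have h := ConcreteCategory.congr_hom hu x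
    refine Eq.trans ?_ h
    exact congrArg ULift.up (mul_one (augmentation A (u.hom x)))
  have hz : ∀ n, 0 < n → (tensorChain (semiMap f) (rightZMap f) h).f n = 0 := by
    rintro (_ | _ | n) hn
    · exact absurd hn (lt_irrefl 0)
    · ext1
      exact TensorOver.hom_ext fun z x ↦ hg_tmul _ (s (v x))
    · ext1
      refine TensorOver.hom_ext fun z x ↦ ?_
      exact congrArg (QuotientAddGroup.mk' _) (TensorProduct.tmul_zero _ _)
  unfold torZMap torMap
  rw [Covers.homologyMap_eq _ (exists_covers _ _ _ _).choose_spec hh,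
    homologyMap_eq_zero _ (hz q hq)]
  exact (congrArg _ Limits.zero_comp).trans Limits.comp_zero

end ProTor

/-! ### The pro-vanishing theorem. -/

theorem mainTheorem7 (p : ℕ) [Fact p.Prime] (X : Type u)
    (I : Ideal (FreeAlgebra (ZMod p) X)) [I.IsTwoSided] (q : ℕ) (hq : 0 < q) :
    ProTor.IsZeroPro (ProTor.proTor I q) := by
  intro m
  have hm : m ≤ m + m := (PNat.lt_add_right m m).le
  refine ⟨m + m, hm, ?_⟩
  let J : Ideal (FreeAlgebra (ZMod p) X) := I ^ (m : ℕ)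
  have hJ : J.IsTwoSided := inferInstance
  have hpow : I ^ ((m + m : ℕ+) : ℕ) = J * J := by
    rw [PNat.add_coe, Ideal.IsTwoSided.pow_add]
  have := FreeAlgebra.projective_ideal J
  obtain ⟨σ, hσ⟩ := Module.projective_def'.1 this
  -- `r` only serves to give `σ` coefficients of type `J`; by `hmem` it changes none of those in
  -- use.
  obtain ⟨r, hr⟩ := J.exists_linearMap_apply_coe (ZMod p)
  let ι := ProTor.idealInclusion (ProTor.pow_le_pow I hm)
  have hmem (a : (I ^ ((m + m : ℕ+) : ℕ) : Ideal (FreeAlgebra (ZMod p) X))) (i : J) :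
      σ (ι a) i ∈ J := by
    -- For `b, c ∈ J`, linearity gives `σ (b • c) = b • σ c`, whose coefficients lie in `J` because
    -- `J` is a right ideal.
    have key : J * J ≤ Submodule.map J.subtype
        (Submodule.comap σ (Finsupp.submodule fun _ : J ↦ J)) := by
      refine Ideal.mul_le.2 fun b hb c hc ↦ ⟨b • ⟨c, hc⟩, fun i ↦ ?_, rfl⟩
      rw [map_smul]
      exact J.mul_mem_right _ hb
    obtain ⟨b, hb, hab⟩ := key (hpow.le a.2)
    rw [show ι a = b from Subtype.ext hab.symm]
    exact hb i
  refine ProTor.torZMap_eq_zero ι (W := J)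
    ((Finsupp.mapRange.addMonoidHom r.toAddMonoidHom).comp
      (σ.toAddMonoidHom.comp ι.toAddMonoidHom)) id ?_ ?_ hq
  · intro a a' i
    change r (σ ((a : FreeAlgebra (ZMod p) X) • ι a') i) = ι a * r (σ (ι a') i)
    have h := J.mul_mem_left a (hmem a' i)
    rw [map_smul, hr ⟨_, hmem a' i⟩]
    exact hr ⟨_, h⟩
  · intro a
    refine Eq.trans (Subtype.ext ?_) (LinearMap.congr_fun hσ (ι a))
    rw [LinearMap.comp_apply, Finsupp.linearCombination_apply,
      Finsupp.sum_of_support_subset (s := (σ (ι a)).support), Finsupp.sum]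
    · rw [AddSubmonoidClass.coe_finsetSum, AddSubmonoidClass.coe_finsetSum]
      refine Finset.sum_congr rfl fun i _ ↦ ?_
      exact congrArg (fun z : J ↦ (z : FreeAlgebra (ZMod p) X) * i) (hr ⟨_, hmem a i⟩)
    · exact Finsupp.support_mapRange (hf := map_zero r)
    · exact fun i _ ↦ zero_mul i
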